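/- Let $R$ be a commutative ring with identity. An $R$-module $M$ is called cotorsion if $\mathrm{Ext}^1_R(F,M)=0$ for every flat $R$-module $F$. A short exact sequence $0\to A\to B\to C\to 0$ of $R$-modules is called pure if it remains exact after tensoring with any $R$-module, and $M$ is called pure-injective if, for every pure short exact sequence $0\to A\to B\to C\to 0$ of $R$-modules, every homomorphism $A\to M$ extends to a homomorphism $B\to M$. If every cotorsion $R$-module is pure-injective, then every prime ideal of $R$ is maximal. -/

import Mathlib

universe u

/-- An `R`-module `M` is cotorsion if `Ext¹_R(F, M) = 0` for every flat `R`-module `F`. -/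
def IsCotorsion (R : Type u) [CommRing R] (M : Type u) [AddCommGroup M] [Module R M] : Prop :=
  ∀ (F : Type u) [AddCommGroup F] [Module R F], Module.Flat R F →
    Subsingleton (CategoryTheory.Abelian.Ext.{u} (ModuleCat.of R F) (ModuleCat.of R M) 1)

/-- The sequence `0 → A → B → C → 0` given by the linear maps `f` and `g` is exact. -/
structure IsShortExactSeq {R : Type u} [CommRing R] {A B C : Type u}
    [AddCommGroup A] [Module R A] [AddCommGroup B] [Module R B] [AddCommGroup C] [Module R C]
    (f : A →ₗ[R] B) (g : B →ₗ[R] C) : Prop where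
  injective : Function.Injective f
  exact : Function.Exact f g
  surjective : Function.Surjective g

/-- The short exact sequence `0 → A → B → C → 0` is pure: it stays exact after tensoring it
with any `R`-module. -/
structure IsPureExactSeq {R : Type u} [CommRing R] {A B C : Type u}
    [AddCommGroup A] [Module R A] [AddCommGroup B] [Module R B] [AddCommGroup C] [Module R C]
    (f : A →ₗ[R] B) (g : B →ₗ[R] C) : Prop where
  shortExact : IsShortExactSeq f g
  tensor : ∀ (N : Type u) [AddCommGroup N] [Module R N],
    IsShortExactSeq (f.lTensor N) (g.lTensor N)

/-- An `R`-module `M` is pure-injective if it is injective relative to every pure exact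
sequence `0 → A → B → C → 0`, that is, every linear map `A → M` extends to `B`. -/
def IsPureInjective (R : Type u) [CommRing R] (M : Type u) [AddCommGroup M] [Module R M] : Prop :=
  ∀ (A B C : Type u) [AddCommGroup A] [Module R A] [AddCommGroup B] [Module R B]
    [AddCommGroup C] [Module R C] (f : A →ₗ[R] B) (g : B →ₗ[R] C),
    IsPureExactSeq f g → ∀ h : A →ₗ[R] M, ∃ k : B →ₗ[R] M, k ∘ₗ f = h

/-! Suppose `a ∈ m \ P` with `P` prime and `m ⊇ P` maximal. Embed `R ⧸ m` in an injective `J` and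
put `T n = J[P + (aⁿ)]`. Each `T n` is cotorsion, being `Hom(R/I, J)` for `I = P + (aⁿ)`, and `T 1 ≠
0` because it contains the image of `R ⧸ m`. The hypothesis makes `T 1` pure-injective, so finite
sums in `T 1` extend to a map `s` on all sequences. Pushing the product of `0 → T 1 → T (n+1) → T n
→ 0` out along `s` gives an extension `M` of `∏ T n` by `T 1`, again cotorsion, hence
pure-injective. In `M` every element of `T 1` is divisible by all `aⁿ`; pure-injectivity turns this
into an infinite chain of divisions by `a`. The chain dies in `∏ T n`, so it lies in `T 1`, which
`a` kills. Thus `T 1 = 0` (`powTorsion_one_eq_bot`), a contradiction. -/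

open Filter TensorProduct

/-! ### Limits and infinite sums in pure-injective modules. -/

section LimitFunctional

variable {R : Type u} [CommRing R] (M : Type u) [AddCommGroup M] [Module R M]

/-- The sequences in `M` that are eventually zero. -/
def eventuallyZero : Submodule R (ℕ → M) where
  carrier := {f | ∀ᶠ n in atTop, f n = 0}
  add_mem' hf hg := by
    filter_upwards [hf, hg] with n h₁ h₂
    simp [h₁, h₂]
  zero_mem' := Eventually.of_forall fun _ => rfl
  smul_mem' r f hf := by
    filter_upwards [hf] with n h
    simp [h]

variable {M}

theorem mem_eventuallyZero {f : ℕ → M} :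
    f ∈ eventuallyZero (R := R) M ↔ ∀ᶠ n in atTop, f n = 0 := Iff.rfl

variable (R M)

/-- The diagonal embedding of `M` into sequences modulo eventually zero sequences. -/
def constGerm : M →ₗ[R] (ℕ → M) ⧸ eventuallyZero (R := R) M :=
  (eventuallyZero M).mkQ ∘ₗ LinearMap.pi fun _ => LinearMap.id

theorem constGerm_injective : Function.Injective (constGerm R M) := by
  rw [injective_iff_map_eq_zero]
  intro m hm
  have h : (fun _ : ℕ => m) ∈ eventuallyZero (R := R) M :=
    (Submodule.Quotient.mk_eq_zero _).1 hm
  obtain ⟨n, hn⟩ := (mem_eventuallyZero.1 h).exists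
  exact hn

/-- The canonical map from `N ⊗ (Mᴺ / ∼)` to `(N ⊗ M)ᴺ / ∼`, where `∼` is eventual equality. -/
def tensorGerm (N : Type u) [AddCommGroup N] [Module R N] :
    N ⊗[R] ((ℕ → M) ⧸ eventuallyZero (R := R) M) →ₗ[R]
      (ℕ → N ⊗[R] M) ⧸ eventuallyZero (R := R) (N ⊗[R] M) :=
  TensorProduct.lift <| LinearMap.flip <| Submodule.liftQ _
    (LinearMap.flip <| LinearMap.mk₂ R
      (fun (x : N) (f : ℕ → M) => (eventuallyZero (R := R) (N ⊗[R] M)).mkQ fun n => x ⊗ₜ f n)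
      (fun x y f => by rw [← map_add]; congr 1; ext n; simp [add_tmul])
      (fun c x f => by rw [← map_smul]; congr 1)
      (fun x f g => by rw [← map_add]; congr 1; ext n; simp [tmul_add])
      (fun c x f => by rw [← map_smul]; congr 1; ext n; simp))
    (by
      intro f hf
      rw [LinearMap.mem_ker]
      ext x
      refine (Submodule.Quotient.mk_eq_zero _).2 ?_
      refine mem_eventuallyZero.2 ?_
      filter_upwards [mem_eventuallyZero.1 hf] with n hn
      simp [hn])

/-- Composing with `tensorGerm` gives the diagonal embedding of `N ⊗ M`, which is injective. -/
theorem constGerm_lTensor_injective (N : Type u) [AddCommGroup N] [Module R N] :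
    Function.Injective ((constGerm R M).lTensor N) := by
  have h : tensorGerm R M N ∘ₗ (constGerm R M).lTensor N = constGerm R (N ⊗[R] M) := by
    ext x m
    rfl
  have h' := constGerm_injective R (N ⊗[R] M)
  rw [← h, LinearMap.coe_comp] at h'
  exact h'.of_comp

theorem isPureExactSeq_constGerm :
    IsPureExactSeq (constGerm R M) (LinearMap.range (constGerm R M)).mkQ where
  shortExact := ⟨constGerm_injective R M, LinearMap.exact_map_mkQ_range _,
    Submodule.mkQ_surjective _⟩
  tensor N _ _ := ⟨constGerm_lTensor_injective R M N,
    lTensor_exact N (LinearMap.exact_map_mkQ_range _) (Submodule.mkQ_surjective _),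
    LinearMap.lTensor_surjective N (Submodule.mkQ_surjective _)⟩

variable {R M}

/-- On a pure-injective module there is a linear functional on sequences which sends every
eventually constant sequence to its eventual value. -/
theorem IsPureInjective.exists_limit (hM : IsPureInjective R M) :
    ∃ l : (ℕ → M) →ₗ[R] M, ∀ (f : ℕ → M) (m : M), (∀ᶠ n in atTop, f n = m) → l f = m := by
  obtain ⟨k, hk⟩ := hM _ _ _ _ _ (isPureExactSeq_constGerm R M) LinearMap.id
  refine ⟨k ∘ₗ (eventuallyZero M).mkQ, fun f m hf => ?_⟩
  have h : (eventuallyZero (R := R) M).mkQ f = constGerm R M m := by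
    refine (Submodule.Quotient.eq _).2 (mem_eventuallyZero.2 ?_)
    filter_upwards [hf] with n hn
    simp [hn]
  rw [LinearMap.comp_apply, h]
  exact LinearMap.congr_fun hk m

/-- On a pure-injective module the sum of finitely supported sequences extends to all sequences. -/
theorem IsPureInjective.exists_sum (hM : IsPureInjective R M) :
    ∃ s : (ℕ → M) →ₗ[R] M, ∀ (n : ℕ) (m : M), s (Pi.single n m) = m := by
  obtain ⟨l, hl⟩ := hM.exists_limit
  -- The sum is the limit of the partial sums.
  refine ⟨l ∘ₗ LinearMap.pi fun n => ∑ i ∈ Finset.range n, LinearMap.proj i, fun n m => ?_⟩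
  refine hl _ _ ?_
  filter_upwards [eventually_gt_atTop n] with k hk
  simp [LinearMap.pi_apply, LinearMap.sum_apply, hk]

/-- In a pure-injective module, an element divisible by all powers of `a` starts an infinite
chain of divisions by `a`. -/
theorem IsPureInjective.exists_chain (hM : IsPureInjective R M) (a : R) (x : M)
    (hx : ∀ n : ℕ, ∃ y, a ^ n • y = x) :
    ∃ z : ℕ → M, z 0 = x ∧ ∀ k, a • z (k + 1) = z k := by
  obtain ⟨l, hl⟩ := hM.exists_limit
  choose y hy using hx
  -- Formally `z k = lim aⁿ⁻ᵏ yₙ`; the terms with `n < k` do not affect the limit.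
  refine ⟨fun k => l fun n => a ^ (n - k) • if k ≤ n then y n else 0, ?_, fun k => ?_⟩
  · exact hl _ _ (Eventually.of_forall fun n => by simp [hy])
  · rw [← map_smul, ← sub_eq_zero, ← map_sub]
    refine hl _ _ ?_
    filter_upwards [eventually_gt_atTop k] with n hn
    have h : n - k = n - (k + 1) + 1 := by omega
    simp [h, hn, hn.le, pow_succ', mul_smul]

end LimitFunctional

/-! ### Sources of cotorsion modules. -/

section Cotorsion

variable {R : Type u} [CommRing R]

/-- Every linear map to `M` from the kernel of a surjection of a projective module `Q` onto a flat
module extends to `Q`. -/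
def ExtendsFromFlatKernels (R : Type u) [CommRing R] (M : Type u) [AddCommGroup M]
    [Module R M] : Prop :=
  ∀ (Q F : Type u) [AddCommGroup Q] [Module R Q] [AddCommGroup F] [Module R F]
    (p : Q →ₗ[R] F), Module.Projective R Q → Module.Flat R F → Function.Surjective p →
    ∀ h : LinearMap.ker p →ₗ[R] M, ∃ g : Q →ₗ[R] M, ∀ x : LinearMap.ker p, g x = h x

-- For `Q` free over `F`, `Ext¹(F, M)` is the cokernel of `Hom(Q, M) → Hom(ker p, M)`.
open CategoryTheory Abelian in
theorem ExtendsFromFlatKernels.isCotorsion {M : Type u} [AddCommGroup M] [Module R M]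
    (hM : ExtendsFromFlatKernels R M) : IsCotorsion R M := by
  intro F _ _ hF
  refine subsingleton_of_forall_eq 0 fun e => ?_
  let p : (F →₀ R) →ₗ[R] F := Finsupp.linearCombination R id
  have hp : Function.Surjective p := Finsupp.linearCombination_id_surjective R F
  have hS := LinearMap.shortExact_shortComplexKer hp
  have : Projective (p.shortComplexKer.X₂) :=
    (IsProjective.iff_projective (R := R) (F →₀ R)).1 inferInstance
  obtain ⟨x, rfl⟩ := Ext.contravariant_sequence_exact₃ hS (ModuleCat.of R M) e
    (Ext.eq_zero_of_projective _) (n₀ := 0) rfl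
  obtain ⟨h, rfl⟩ := Ext.addEquiv₀.symm.surjective x
  obtain ⟨g, hg⟩ := hM _ _ p inferInstance hF hp h.hom
  have hh : h = p.shortComplexKer.f ≫ ModuleCat.ofHom g := by
    ext x
    exact (hg x).symm
  subst hh
  change hS.extClass.comp (Ext.mk₀ (p.shortComplexKer.f ≫ ModuleCat.ofHom g)) _ = 0
  rw [← Ext.mk₀_comp_mk₀, hS.extClass_comp_assoc]

theorem ExtendsFromFlatKernels.pi {ι : Type} {M : ι → Type u} [∀ i, AddCommGroup (M i)]
    [∀ i, Module R (M i)] (hM : ∀ i, ExtendsFromFlatKernels R (M i)) :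
    ExtendsFromFlatKernels R (∀ i, M i) := by
  intro Q F _ _ _ _ p hQ hF hp h
  choose g hg using fun i => hM i Q F p hQ hF hp (LinearMap.proj i ∘ₗ h)
  exact ⟨LinearMap.pi g, fun x => funext fun i => hg i x⟩

/-- An extension of `q ∘ h` to `Q` lifts to `M` since `Q` is projective; the error on `ker p` takes
values in `A` and is extended there. -/
theorem ExtendsFromFlatKernels.of_exact {A M B : Type u} [AddCommGroup A] [Module R A]
    [AddCommGroup M] [Module R M] [AddCommGroup B] [Module R B]
    (hA : ExtendsFromFlatKernels R A) (hB : ExtendsFromFlatKernels R B)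
    {i : A →ₗ[R] M} {q : M →ₗ[R] B} (hiq : IsShortExactSeq i q) :
    ExtendsFromFlatKernels R M := by
  intro Q F _ _ _ _ p hQ hF hp h
  obtain ⟨g, hg⟩ := hB Q F p hQ hF hp (q ∘ₗ h)
  obtain ⟨g', rfl⟩ := Module.projective_lifting_property q g hiq.surjective
  let d : LinearMap.ker p →ₗ[R] LinearMap.range i :=
    (h - g' ∘ₗ (LinearMap.ker p).subtype).codRestrict _ fun x => by
      refine (hiq.exact _).1 ?_
      have := hg x
      simp only [LinearMap.comp_apply] at this
      simp [this]
  let e := LinearEquiv.ofInjective i hiq.injective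
  obtain ⟨k, hk⟩ := hA Q F p hQ hF hp (e.symm.toLinearMap ∘ₗ d)
  refine ⟨g' + i ∘ₗ k, fun x => ?_⟩
  have h₁ : i (e.symm (d x)) = d x := congrArg Subtype.val (e.apply_symm_apply (d x))
  have h₂ : (d x : M) = h x - g' x := rfl
  simp only [LinearMap.add_apply, LinearMap.comp_apply, hk, LinearEquiv.coe_coe, h₁, h₂]
  exact add_sub_cancel _ _

/-- If `Q / N` is flat, then `N ∩ I Q ⊆ I N`. -/
theorem mem_smul_top_of_flat {Q F : Type u} [AddCommGroup Q] [Module R Q] [AddCommGroup F]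
    [Module R F] {p : Q →ₗ[R] F} [Module.Flat R F] (hp : Function.Surjective p) (I : Ideal R)
    (x : LinearMap.ker p) (hx : (x : Q) ∈ I • (⊤ : Submodule R Q)) :
    x ∈ I • (⊤ : Submodule R (LinearMap.ker p)) := by
  let m (L : Type u) [AddCommGroup L] [Module R L] : I ⊗[R] L →ₗ[R] L :=
    TensorProduct.lid R L ∘ₗ I.subtype.rTensor L
  have hm {L L' : Type u} [AddCommGroup L] [Module R L] [AddCommGroup L'] [Module R L']
      (f : L →ₗ[R] L') (t : I ⊗[R] L) : m L' (f.lTensor I t) = f (m L t) := by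
    induction t with
    | zero => simp
    | tmul r y => simp [m]
    | add s t hs ht => simp [hs, ht]
  have hmem (L : Type u) [AddCommGroup L] [Module R L] (t : I ⊗[R] L) :
      m L t ∈ I • (⊤ : Submodule R L) := by
    induction t with
    | zero => simp
    | tmul r y => exact Submodule.smul_mem_smul r.2 trivial
    | add s t hs ht => rw [map_add]; exact add_mem hs ht
  obtain ⟨t, ht⟩ : ∃ t : I ⊗[R] Q, m Q t = x := by
    refine Submodule.smul_induction_on hx (fun r hr y _ => ⟨⟨r, hr⟩ ⊗ₜ y, by simp [m]⟩) ?_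
    rintro _ _ ⟨s, rfl⟩ ⟨t, rfl⟩
    exact ⟨s + t, map_add _ _ _⟩
  -- By flatness, a lift of `x` to `I ⊗ Q` vanishes already in `I ⊗ F`, so it comes from `I ⊗ ker
  -- p`.
  have hinj : Function.Injective (m F) :=
    (TensorProduct.lid R F).injective.comp
      (Module.Flat.rTensor_preserves_injective_linearMap _ I.subtype_injective)
  have h₀ : p.lTensor I t = 0 := hinj (by rw [hm, ht, map_zero]; exact x.2)
  obtain ⟨s, rfl⟩ := (lTensor_exact I (LinearMap.exact_subtype_ker_map p) hp t).1 h₀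
  rw [hm] at ht
  rw [← Subtype.ext ht]
  exact hmem _ s

/-- With `N = ker p`, a map `N → J[I]` factors through `N/IN`, which embeds in `Q/IQ` by flatness of
`F`; injectivity of `J` extends it, and maps from `Q/IQ` land in `J[I]`. -/
theorem ExtendsFromFlatKernels.torsionBySet {J : Type u} [AddCommGroup J] [Module R J]
    [Module.Injective R J] (I : Ideal R) :
    ExtendsFromFlatKernels R (Submodule.torsionBySet R J I) := by
  intro Q F _ _ _ _ p hQ hF hp h
  let N := LinearMap.ker p
  let T : Submodule R N := I • ⊤
  let S : Submodule R Q := I • ⊤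
  have hTS : T ≤ S.comap N.subtype := by
    refine Submodule.smul_le.2 fun r hr y _ => ?_
    exact Submodule.smul_mem_smul hr trivial
  have hker : T ≤ LinearMap.ker ((Submodule.torsionBySet R J I).subtype ∘ₗ h) := by
    refine Submodule.smul_le.2 fun r hr y _ => ?_
    simpa using (Submodule.mem_torsionBySet_iff _ _).1 (h y).2 ⟨r, hr⟩
  have hinj : Function.Injective (T.mapQ S N.subtype hTS) := by
    rw [injective_iff_map_eq_zero]
    intro y hy
    obtain ⟨y, rfl⟩ := Submodule.mkQ_surjective _ y
    refine (Submodule.Quotient.mk_eq_zero _).2 (mem_smul_top_of_flat hp I y ?_)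
    exact (Submodule.Quotient.mk_eq_zero _).1 hy
  obtain ⟨k, hk⟩ := Module.Injective.out _ hinj (T.liftQ _ hker)
  refine ⟨(k ∘ₗ S.mkQ).codRestrict _ fun y => ?_, fun y => Subtype.ext (hk (T.mkQ y))⟩
  refine (Submodule.mem_torsionBySet_iff _ _).2 fun r => ?_
  rw [LinearMap.comp_apply]
  change (r : R) • k (S.mkQ y) = 0
  rw [← map_smul, ← map_smul, Submodule.mkQ_apply, (Submodule.Quotient.mk_eq_zero _).2, map_zero]
  exact Submodule.smul_mem_smul r.2 trivial

end Cotorsion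

/-! ### Pushouts of short exact sequences. -/

section Pushout

variable {R : Type u} [CommRing R] {A B C A' : Type u} [AddCommGroup A] [Module R A]
  [AddCommGroup B] [Module R B] [AddCommGroup C] [Module R C] [AddCommGroup A'] [Module R A']

/-- Short exact sequences can be pushed out along maps from their first term. -/
theorem IsShortExactSeq.exists_pushout {f : A →ₗ[R] B} {g : B →ₗ[R] C}
    (hfg : IsShortExactSeq f g) (s : A →ₗ[R] A') :
    ∃ (M : Type u) (_ : AddCommGroup M) (_ : Module R M) (i : A' →ₗ[R] M) (j : B →ₗ[R] M)
      (q : M →ₗ[R] C), IsShortExactSeq i q ∧ i ∘ₗ s = j ∘ₗ f := by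
  let L : Submodule R (A' × B) := LinearMap.range (s.prod (-f))
  have hL : L ≤ LinearMap.ker (g ∘ₗ LinearMap.snd R A' B) := by
    rintro _ ⟨x, rfl⟩
    simp [hfg.exact.apply_apply_eq_zero]
  refine ⟨(A' × B) ⧸ L, inferInstance, inferInstance, L.mkQ ∘ₗ LinearMap.inl R A' B,
    L.mkQ ∘ₗ LinearMap.inr R A' B, L.liftQ _ hL, ⟨?_, ?_, ?_⟩, ?_⟩
  · rw [injective_iff_map_eq_zero]
    intro x hx
    obtain ⟨y, hy⟩ : (x, (0 : B)) ∈ L := (Submodule.Quotient.mk_eq_zero _).1 hx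
    have h₂ : -f y = 0 := congrArg Prod.snd hy
    have h₁ : s y = x := congrArg Prod.fst hy
    rw [neg_eq_zero, map_eq_zero_iff f hfg.injective] at h₂
    rw [← h₁, h₂, map_zero]
  · intro x
    constructor
    · intro hx
      obtain ⟨⟨x, y⟩, rfl⟩ := L.mkQ_surjective x
      obtain ⟨w, rfl⟩ := (hfg.exact y).1 hx
      refine ⟨x + s w, (Submodule.Quotient.eq _).2 ⟨w, ?_⟩⟩
      simp
    · rintro ⟨x, rfl⟩
      exact map_zero g
  · intro c
    obtain ⟨b, rfl⟩ := hfg.surjective c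
    exact ⟨L.mkQ (0, b), rfl⟩
  · ext x
    refine (Submodule.Quotient.eq _).2 ⟨x, ?_⟩
    simp

end Pushout

/-! ### Torsion submodules of an injective module. -/

section Torsion

variable {R : Type u} [CommRing R] (J : Type u) [AddCommGroup J] [Module R J]
  (P : Ideal R) (a : R)

/-- The submodule of elements of `J` annihilated by `P` and by `a ^ n`. -/
abbrev powTorsion (n : ℕ) : Submodule R J :=
  Submodule.torsionBySet R J (P ⊔ Ideal.span {a ^ n} : Ideal R)

variable {J P a}

theorem mem_powTorsion {n : ℕ} {x : J} :
    x ∈ powTorsion J P a n ↔ (∀ r ∈ P, r • x = 0) ∧ a ^ n • x = 0 := by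
  have h (I : Ideal R) :
      x ∈ Submodule.torsionBySet R J I ↔ I ≤ LinearMap.ker (LinearMap.toSpanSingleton R J x) := by
    rw [Submodule.mem_torsionBySet_iff]
    exact ⟨fun h r hr => h ⟨r, hr⟩, fun h r => h r.2⟩
  rw [h, sup_le_iff, Ideal.span_singleton_le_iff_mem]
  rfl

theorem exists_smul_eq_of_mem_powTorsion [Module.Injective R J] [P.IsPrime] (ha : a ∉ P) {n : ℕ}
    (x : powTorsion J P a n) : ∃ y : powTorsion J P a (n + 1), a • (y : J) = x := by
  have hx := mem_powTorsion.1 x.2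
  have hinj : Function.Injective (LinearMap.lsmul R (R ⧸ P) a) := by
    rw [injective_iff_map_eq_zero]
    intro r hr
    obtain ⟨r, rfl⟩ := Ideal.Quotient.mk_surjective r
    have h : Ideal.Quotient.mk P (a * r) = 0 := hr
    rw [Ideal.Quotient.eq_zero_iff_mem] at h ⊢
    exact (Ideal.IsPrime.mem_or_mem ‹_› h).resolve_left ha
  -- Extend `r ↦ r • x` along multiplication by `a` on the domain `R ⧸ P`; the image of `1` is the
  -- quotient of `x` by `a`.
  obtain ⟨k, hk⟩ := Module.Injective.out _ hinj
    (Submodule.liftQ P (LinearMap.toSpanSingleton R J (x : J)) hx.1)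
  have hk₁ : a • k (Submodule.Quotient.mk 1) = x := by
    rw [← map_smul]
    exact (hk (Submodule.Quotient.mk 1)).trans (one_smul R (x : J))
  refine ⟨⟨k (Submodule.Quotient.mk 1), mem_powTorsion.2 ⟨fun r hr => ?_, ?_⟩⟩, hk₁⟩
  · rw [← map_smul, ← Submodule.Quotient.mk_smul, (Submodule.Quotient.mk_eq_zero P).2, map_zero]
    simpa using hr
  · rw [pow_succ, mul_smul, hk₁, hx.2]

theorem exists_pow_smul_eq_of_mem_powTorsion [Module.Injective R J] [P.IsPrime] (ha : a ∉ P)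
    (x : powTorsion J P a 1) (n : ℕ) : ∃ y : powTorsion J P a (n + 1), a ^ n • (y : J) = x := by
  induction n with
  | zero => exact ⟨x, by simp⟩
  | succ n ih =>
    obtain ⟨y, hy⟩ := ih
    obtain ⟨z, hz⟩ := exists_smul_eq_of_mem_powTorsion ha y
    exact ⟨z, by rw [pow_succ, mul_smul, hz, hy]⟩

variable (J P a)

theorem powTorsion_one_le (n : ℕ) : powTorsion J P a 1 ≤ powTorsion J P a (n + 1) := by
  intro x hx
  rw [mem_powTorsion, pow_one] at hx
  exact mem_powTorsion.2 ⟨hx.1, by rw [pow_succ, mul_smul, hx.2, smul_zero]⟩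

/-- The inclusion of the `a`-torsion into the `a ^ (n + 1)`-torsion. -/
def powTorsionIncl (n : ℕ) : powTorsion J P a 1 →ₗ[R] powTorsion J P a (n + 1) :=
  Submodule.inclusion (powTorsion_one_le J P a n)

/-- Multiplication by `a` from the `a ^ (n + 1)`-torsion to the `a ^ n`-torsion. -/
def powTorsionSMul (n : ℕ) : powTorsion J P a (n + 1) →ₗ[R] powTorsion J P a n where
  toFun x := ⟨a • (x : J), mem_powTorsion.2
    ⟨fun r hr => by rw [smul_comm, (mem_powTorsion.1 x.2).1 r hr, smul_zero],
      by rw [smul_smul, ← pow_succ, (mem_powTorsion.1 x.2).2]⟩⟩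
  map_add' x y := Subtype.ext (smul_add a (x : J) y)
  map_smul' r x := Subtype.ext (smul_comm a r (x : J))

variable {J P a}

@[simp]
theorem coe_powTorsionIncl {n : ℕ} (x : powTorsion J P a 1) :
    (powTorsionIncl J P a n x : J) = x :=
  Submodule.coe_inclusion (powTorsion_one_le J P a n) x

@[simp]
theorem coe_powTorsionSMul {n : ℕ} (x : powTorsion J P a (n + 1)) :
    (powTorsionSMul J P a n x : J) = a • (x : J) := rfl

variable (J)

/-- The product over all `n` of the exact sequences
`0 → J[P + (a)] → J[P + (aⁿ⁺¹)] → J[P + (aⁿ)] → 0`. -/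
theorem isShortExactSeq_pi_powTorsion [Module.Injective R J] [P.IsPrime] (ha : a ∉ P) :
    IsShortExactSeq
      (LinearMap.pi fun n => powTorsionIncl J P a n ∘ₗ LinearMap.proj n :
        (ℕ → powTorsion J P a 1) →ₗ[R] ∀ n, powTorsion J P a (n + 1))
      (LinearMap.pi fun n => powTorsionSMul J P a n ∘ₗ LinearMap.proj n :
        (∀ n, powTorsion J P a (n + 1)) →ₗ[R] ∀ n, powTorsion J P a n) where
  injective x y h := by
    funext n
    have h' := congrArg Subtype.val (congrFun h n)
    simp only [LinearMap.pi_apply, LinearMap.comp_apply, LinearMap.proj_apply,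
      coe_powTorsionIncl] at h'
    exact Subtype.ext h'
  exact y := by
    constructor
    · intro h
      have h' (n : ℕ) : a ^ 1 • (y n : J) = 0 := by
        have h' := congrArg Subtype.val (congrFun h n)
        simp only [LinearMap.pi_apply, LinearMap.comp_apply, LinearMap.proj_apply,
          coe_powTorsionSMul] at h'
        rw [pow_one, h']
        rfl
      refine ⟨fun n => ⟨y n, mem_powTorsion.2 ⟨(mem_powTorsion.1 (y n).2).1, h' n⟩⟩, ?_⟩
      funext n
      refine Subtype.ext ?_
      simp only [LinearMap.pi_apply, LinearMap.comp_apply, LinearMap.proj_apply,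
        coe_powTorsionIncl]
    · rintro ⟨x, rfl⟩
      funext n
      refine Subtype.ext ?_
      have h := (mem_powTorsion.1 (x n).2).2
      rw [pow_one] at h
      simp only [LinearMap.pi_apply, LinearMap.comp_apply, LinearMap.proj_apply,
        coe_powTorsionSMul, coe_powTorsionIncl, h]
      rfl
  surjective x := by
    choose y hy using fun n => exists_smul_eq_of_mem_powTorsion ha (x n)
    refine ⟨y, funext fun n => Subtype.ext ?_⟩
    simp only [LinearMap.pi_apply, LinearMap.comp_apply, LinearMap.proj_apply,
      coe_powTorsionSMul, hy]

end Torsion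

/-! ### Vanishing of the torsion and the conclusion. -/

section Main

variable {R : Type u} [CommRing R]

theorem powTorsion_one_eq_bot
    (hR : ∀ (M : Type u) [AddCommGroup M] [Module R M], IsCotorsion R M → IsPureInjective R M)
    (J : Type u) [AddCommGroup J] [Module R J] [Module.Injective R J] (P : Ideal R) [P.IsPrime]
    {a : R} (ha : a ∉ P) (x : powTorsion J P a 1) : x = 0 := by
  have hcot (n : ℕ) : ExtendsFromFlatKernels R (powTorsion J P a n) := .torsionBySet _
  obtain ⟨s, hs⟩ := (hR _ (hcot 1).isCotorsion).exists_sum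
  obtain ⟨M, _, _, i, j, q, hiq, hij⟩ :=
    (isShortExactSeq_pi_powTorsion J ha).exists_pushout s
  have hM : IsPureInjective R M := hR _ ((hcot 1).of_exact (.pi hcot) hiq).isCotorsion
  have hdiv (n : ℕ) : ∃ y, a ^ n • y = i x := by
    obtain ⟨y, hy⟩ := exists_pow_smul_eq_of_mem_powTorsion ha x n
    -- `aⁿ` times this is the image of the sequence with `x` in place `n`, whose sum is `x`; the
    -- pushout square identifies it with `i x`.
    refine ⟨j (Pi.single n y), ?_⟩
    have h₁ : i x = i (s (Pi.single n x)) := by rw [hs]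
    rw [h₁, ← map_smul, ← LinearMap.comp_apply i s, hij, LinearMap.comp_apply]
    congr 1
    funext m
    rcases eq_or_ne m n with rfl | hmn
    · refine Subtype.ext ?_
      rw [Pi.smul_apply, Pi.single_eq_same, Submodule.coe_smul, hy, LinearMap.pi_apply,
        LinearMap.comp_apply, LinearMap.proj_apply, Pi.single_eq_same, coe_powTorsionIncl]
    · rw [Pi.smul_apply, Pi.single_eq_of_ne hmn, LinearMap.pi_apply,
        LinearMap.comp_apply, LinearMap.proj_apply, Pi.single_eq_of_ne hmn, map_zero, smul_zero]
  obtain ⟨z, hz₀, hz⟩ := hM.exists_chain a (i x) hdiv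
  have hpow (n k : ℕ) : a ^ n • z (k + n) = z k := by
    induction n with
    | zero => simp
    | succ n ih => rw [pow_succ, mul_smul, ← add_assoc, hz, ih]
  -- The coordinate in `T n` is divisible by `aⁿ`, which annihilates `T n`.
  have hq (k : ℕ) : q (z k) = 0 := by
    funext n
    rw [← hpow n k, map_smul, Pi.smul_apply, Pi.zero_apply]
    refine Subtype.ext ?_
    rw [Submodule.coe_smul, (mem_powTorsion.1 (q (z (k + n)) n).2).2, Submodule.coe_zero]
  obtain ⟨w, hw⟩ := (hiq.exact (z 1)).1 (hq 1)
  have haw : a • w = 0 := by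
    refine Subtype.ext ?_
    have h := (mem_powTorsion.1 w.2).2
    rw [pow_one] at h
    rw [Submodule.coe_smul, h, Submodule.coe_zero]
  refine hiq.injective ?_
  rw [← hz₀, ← hz 0, zero_add, ← hw, ← map_smul, haw]

/-- Every module embeds into an injective module. -/
theorem exists_injective_embedding (N : Type u) [AddCommGroup N] [Module R N] :
    ∃ (J : Type u) (_ : AddCommGroup J) (_ : Module R J) (f : N →ₗ[R] J),
      Module.Injective R J ∧ Function.Injective f := by
  obtain ⟨J, hJ, f, hf⟩ := CategoryTheory.EnoughInjectives.presentation (ModuleCat.of R N)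
  exact ⟨J, inferInstance, inferInstance, f.hom,
    Module.injective_module_of_injective_object R J (inj := hJ),
    (ModuleCat.mono_iff_injective f).1 hf⟩

end Main

theorem proposition3p5 (R : Type u) [CommRing R]
    (hR : ∀ (M : Type u) [AddCommGroup M] [Module R M], IsCotorsion R M → IsPureInjective R M)
    (P : Ideal R) (hP : P.IsPrime) : P.IsMaximal := by
  obtain ⟨m, hm, hPm⟩ := P.exists_le_maximal hP.ne_top
  rcases hPm.eq_or_lt with rfl | hlt
  · exact hm
  obtain ⟨-, a, ham, haP⟩ := SetLike.lt_iff_le_and_exists.1 hlt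
  obtain ⟨J, _, _, f, hJ, hf⟩ := exists_injective_embedding (R := R) (R ⧸ m)
  have hkill (r : R) (hr : r ∈ m) : r • f 1 = 0 := by
    rw [← map_smul, ← map_zero f]
    congr 1
    rw [Algebra.smul_def, mul_one]
    exact Ideal.Quotient.eq_zero_iff_mem.2 hr
  -- `f 1` is killed by `m ⊇ P + (a)`, so it lies in `T 1`.
  have h := powTorsion_one_eq_bot hR J P haP
    ⟨f 1, mem_powTorsion.2 ⟨fun r hr => hkill r (hPm hr), by simpa using hkill a ham⟩⟩
  have h₁ : f 1 = 0 := congrArg Subtype.val h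
  exact absurd ((map_eq_zero_iff f hf).1 h₁) one_ne_zero
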